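/- Let $P\in\mathbb R^{N\times N}$ be an irreducible, aperiodic (row-)stochastic matrix with stationary distribution $\pi$, and let $\beta\in\mathbb R^N$. With the convention $0\log 0=0$, let $H(P)=-\sum_{i,j}\pi_iP_{ij}\log P_{ij}$. Let $$\Delta=\Big\{\theta\in\mathbb R_+^{N\times N}:\ \sum_{i,j}\theta_{ij}=1,\ \sum_j\theta_{ij}=\sum_j\theta_{ji}\ \text{for all } i,\ \theta_{ij}=0 \text{ whenever } P_{ij}=0\Big\},$$ and for $\theta\in\Delta$ put $\overline\theta_i=\sum_j\theta_{ij}$, $$H(\theta)=-\sum_{i,j}\theta_{ij}\log\frac{\theta_{ij}}{\overline\theta_i},\qquad D(\theta\|P)=\sum_{i,j}\theta_{ij}\log\frac{\theta_{ij}}{\overline\theta_iP_{ij}}$$ (terms with $\theta_{ij}=0$ are $0$). For $\xi\in\mathbb R^N$ let $J_\theta(\xi)=\sum_{i:\overline\theta_i>0}\frac{1}{\overline\theta_i}\frac{\xi_i^2}{2}$ if $\xi_i=0$ for every $i$ with $\overline\theta_i=0$, and $J_\theta(\xi)=+\infty$ otherwise. Let $\underline\zeta$ be the optimal value of the problem $$(A)\qquad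 \text{minimize}\quad D(\theta\|P)+\sum_{i:\overline\theta_i>0}\overline\theta_i\,\frac{\big(\beta_i-\xi_i/\overline\theta_i\big)^2}{2}\quad\text{subject to}\quad \theta\in\Delta,\ \xi\in\mathbb R^N,\ H(\theta)\ge J_\theta(\xi).$$ The optimal value $\underline\zeta$ of (A) is attained, and the following hold. 1. If $H(P)\ge\sum_i\pi_i\beta_i^2/2$, then $\underline\zeta=0$. 2. The problem $$(B)\qquad \text{minimize}\quad -\sum_{i,j}\theta_{ij}\log P_{ij}+\sum_i\overline\theta_i\frac{\beta_i^2}{2}-2\sqrt{\sum_i\overline\theta_i\frac{\beta_i^2}{2}}\,\sqrt{H(\theta)}\quad\text{subject to}\quad\theta\in\Delta$$ is a convex optimization problem (the set $\Delta$ is convex and the objective is convex on it). If $H(P)<\sum_i\pi_i\beta_i^2/2$, then (A) is equivalent to (B): the optimal value of (B) is attained and equals $\underline\zeta$, and $\theta$ is an optimal solution of (B) if and only if there is $\xi\in\mathbb R^N$ such that $(\theta,\xi)$ is an optimal solution of (A). -/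

import Mathlib

open scoped Matrix

noncomputable section

namespace RandomWalkDetection

variable {N : ℕ}

/-- Aperiodicity of a nonnegative matrix: for every state `i`, the greatest common divisor of the
possible return times `{n : (P ^ n) i i > 0}` is `1`, that is, the only common divisor of these
return times is `1` (the time `n = 0` imposes no restriction on a divisor). -/
def IsAperiodic (P : Matrix (Fin N) (Fin N) ℝ) : Prop :=
  ∀ i : Fin N, ∀ d : ℕ, (∀ n : ℕ, 0 < (P ^ n) i i → d ∣ n) → d = 1

/-- `π` is a stationary distribution of the transition matrix `P`. -/
def IsStationary (P : Matrix (Fin N) (Fin N) ℝ) (π : Fin N → ℝ) : Prop :=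
  π ∈ stdSimplex ℝ (Fin N) ∧ π ᵥ* P = π

/-- The vector `θ̄` of row sums of `θ`. -/
def rowSum (θ : Matrix (Fin N) (Fin N) ℝ) (i : Fin N) : ℝ :=
  ∑ j, θ i j

/-- The set `Δ` of limiting Markov types: probability matrices with equal row and column marginals,
supported on the edges of the graph of the walk, which are the pairs with `P i j ≠ 0`. -/
def markovTypes (P : Matrix (Fin N) (Fin N) ℝ) : Set (Matrix (Fin N) (Fin N) ℝ) :=
  {θ | ∑ i, ∑ j, θ i j = 1 ∧ (∀ i, ∑ j, θ i j = ∑ j, θ j i) ∧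
    (∀ i j, 0 ≤ θ i j) ∧ ∀ i j, P i j = 0 → θ i j = 0}

/-- The entropy function `H(θ)` (with `0 log 0 = 0`). -/
def entropy (θ : Matrix (Fin N) (Fin N) ℝ) : ℝ :=
  -∑ i, ∑ j, θ i j * Real.log (θ i j / rowSum θ i)

/-- The entropy rate `H(P)` of the stationary Markov chain with transition matrix `P` and
stationary distribution `π`. -/
def entropyRate (P : Matrix (Fin N) (Fin N) ℝ) (π : Fin N → ℝ) : ℝ :=
  -∑ i, ∑ j, π i * P i j * Real.log (P i j)

/-- The relative entropy `D(θ || P)`. It is used on `markovTypes P` only, where `θ i j = 0`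
whenever `P i j = 0`, so that such terms are `0`. -/
def relEntropy (θ P : Matrix (Fin N) (Fin N) ℝ) : ℝ :=
  ∑ i, ∑ j, θ i j * Real.log (θ i j / (rowSum θ i * P i j))

open Classical in
/-- The function `J_θ(ξ)`, with value `+∞` if `ξ i ≠ 0` for some `i` with `θ̄ i = 0`. -/
def J (θ : Matrix (Fin N) (Fin N) ℝ) (ξ : Fin N → ℝ) : EReal :=
  if ∀ i, rowSum θ i = 0 → ξ i = 0 then
    ((∑ i with 0 < rowSum θ i, 1 / rowSum θ i * (ξ i ^ 2 / 2) : ℝ) : EReal)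
  else ⊤

/-- The objective of the optimization problem that defines the lower bound on the error exponent,
as a function of the pair `(θ, ξ)`. -/
def boundObjective (P : Matrix (Fin N) (Fin N) ℝ) (β : Fin N → ℝ)
    (x : Matrix (Fin N) (Fin N) ℝ × (Fin N → ℝ)) : ℝ :=
  relEntropy x.1 P +
    ∑ i with 0 < rowSum x.1 i,
      rowSum x.1 i * ((β i - 1 / rowSum x.1 i * x.2 i) ^ 2 / 2)

/-- The constraint set of that problem: `θ ∈ Δ`, `ξ ∈ ℝᴺ` and `H(θ) ≥ J_θ(ξ)`. -/
def boundFeasible (P : Matrix (Fin N) (Fin N) ℝ) :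
    Set (Matrix (Fin N) (Fin N) ℝ × (Fin N → ℝ)) :=
  {x | x.1 ∈ markovTypes P ∧ J x.1 x.2 ≤ (entropy x.1 : EReal)}

/-- The lower bound on the error exponent: the optimal value of that problem. -/
def zetaLower (P : Matrix (Fin N) (Fin N) ℝ) (β : Fin N → ℝ) : ℝ :=
  sInf (boundObjective P β '' boundFeasible P)

/-- `R(θ) = ∑ i, θ̄ i * β i ^ 2 / 2`. -/
def meanSNR (β : Fin N → ℝ) (θ : Matrix (Fin N) (Fin N) ℝ) : ℝ :=
  ∑ i, rowSum θ i * (β i ^ 2 / 2)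

/-- The objective of the convex reformulation. -/
def cvxObjective (P : Matrix (Fin N) (Fin N) ℝ) (β : Fin N → ℝ)
    (θ : Matrix (Fin N) (Fin N) ℝ) : ℝ :=
  -∑ i, ∑ j, θ i j * Real.log (P i j) + meanSNR β θ
    - 2 * √(meanSNR β θ) * √(entropy θ)

end RandomWalkDetection

end

namespace RandomWalkDetection

open Finset InformationTheory

variable {N : ℕ}

/-! ### The relative entropy function on pairs of reals -/

/-! Write R(θ) for `meanSNR β θ` and D(θ) for `relEntropy θ P`. Substituting ξ_i = θ̄_i κ_i turns
the inner problem over ξ into geometry: in the norm with weights θ̄_i / 2, the constraint puts κ in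
the ball of radius √H(θ), and the quadratic cost is the squared distance from β, which has norm
√R(θ). Hence (A) reduces to minimizing D(θ) + max(0, √R - √H)² over Δ (`reducedObjective_le`,
`exists_boundObjective_eq`). This function is continuous on a compact set, so the minimum is
attained.

Since D ≥ 0 vanishes on Δ only at the stationary pair distribution, where H(θ) = H(P), the
large-entropy case is immediate.

The objective of (B) equals D + (√R - √H)². It dominates the reduced objective and agrees with it
where H ≤ R. When H(P) is small, a minimizer with H > R would have D > 0; moving it toward the pair
distribution until H = R would strictly lower D (`entropy_le_meanSNR_of_isMinOn`). So the minimizers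
of the reduced objective lie where the two agree. Convexity of (B) holds because its first two terms
are linear, H is concave, and the geometric mean is jointly concave and monotone. -/

lemma mul_log_div_ge {a c r : ℝ} (ha : 0 ≤ a) (hc : 0 ≤ c) (hac : c = 0 → a = 0) (hr : 0 < r) :
    a * Real.log r + a - c * r ≤ a * Real.log (a / c) := by
  rcases ha.eq_or_lt with rfl | ha
  · simpa using mul_nonneg hc hr.le
  have hc : 0 < c := lt_of_le_of_ne hc fun h => ha.ne' (hac h.symm)
  -- The bound is log x ≤ x - 1 at x = r c / a; equality holds when r = a / c.
  have h := Real.log_le_sub_one_of_pos (show 0 < r * c / a by positivity)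
  rw [Real.log_div (by positivity) ha.ne', Real.log_mul hr.ne' hc.ne'] at h
  have h2 := mul_le_mul_of_nonneg_left h ha.le
  have h3 : a * (r * c / a - 1) = r * c - a := by field_simp
  rw [Real.log_div ha.ne' hc.ne']
  linarith

/-- Log-sum inequality: apply `mul_log_div_ge` to both pairs at the common ratio r of the two
mixtures. The linear corrections cancel because (t c + s d) r = t a + s b. -/
lemma mul_log_div_convex {a b c d t s : ℝ} (ha : 0 ≤ a) (hb : 0 ≤ b) (hc : 0 ≤ c) (hd : 0 ≤ d)
    (hac : c = 0 → a = 0) (hbd : d = 0 → b = 0) (ht : 0 ≤ t) (hs : 0 ≤ s) :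
    (t * a + s * b) * Real.log ((t * a + s * b) / (t * c + s * d)) ≤
      t * (a * Real.log (a / c)) + s * (b * Real.log (b / d)) := by
  have h0 : 0 ≤ t * a := by positivity
  have h1 : 0 ≤ s * b := by positivity
  rcases (add_nonneg h0 h1).eq_or_lt with h | h
  · have h2 : t * a = 0 := by linarith
    have h3 : s * b = 0 := by linarith
    rw [← h, ← mul_assoc, ← mul_assoc, h2, h3]
    simp
  have hC : 0 < t * c + s * d := by
    refine lt_of_le_of_ne (by positivity) fun h' => h.ne' ?_
    have h2 : t * c = 0 := by nlinarith [mul_nonneg ht hc, mul_nonneg hs hd]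
    have h3 : s * d = 0 := by nlinarith [mul_nonneg ht hc, mul_nonneg hs hd]
    rcases mul_eq_zero.1 h2 with h2 | h2 <;> rcases mul_eq_zero.1 h3 with h3 | h3 <;>
      simp [h2, h3, hac, hbd]
  set r := (t * a + s * b) / (t * c + s * d) with hr
  have hr0 : 0 < r := div_pos h hC
  have e : (t * c + s * d) * r = t * a + s * b := by rw [hr]; field_simp
  have k1 := mul_le_mul_of_nonneg_left (mul_log_div_ge ha hc hac hr0) ht
  have k2 := mul_le_mul_of_nonneg_left (mul_log_div_ge hb hd hbd hr0) hs
  linarith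

/-- The geometric mean is jointly concave. -/
lemma sqrt_mul_sqrt_concave {a b c d t s : ℝ} (ha : 0 ≤ a) (hb : 0 ≤ b) (hc : 0 ≤ c) (hd : 0 ≤ d)
    (ht : 0 ≤ t) (hs : 0 ≤ s) :
    t * (√a * √b) + s * (√c * √d) ≤ √(t * a + s * c) * √(t * b + s * d) := by
  rw [← Real.sqrt_mul (show 0 ≤ t * a + s * c by positivity)]
  apply Real.le_sqrt_of_sq_le
  have e1 := Real.sq_sqrt ha
  have e2 := Real.sq_sqrt hb
  have e3 := Real.sq_sqrt hc
  have e4 := Real.sq_sqrt hd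
  have : (t * a + s * c) * (t * b + s * d) - (t * (√a * √b) + s * (√c * √d)) ^ 2
      = t * s * (√a * √d - √c * √b) ^ 2 := by
    rw [← e1, ← e2, ← e3, ← e4]
    simp only [Real.sqrt_sq (Real.sqrt_nonneg _)]
    ring
  nlinarith [mul_nonneg (mul_nonneg ht hs) (sq_nonneg (√a * √d - √c * √b))]

/-! ### The set of Markov types -/

variable {P : Matrix (Fin N) (Fin N) ℝ} {β : Fin N → ℝ} {π : Fin N → ℝ}
  {θ η : Matrix (Fin N) (Fin N) ℝ}

lemma rowSum_nonneg (hθ : θ ∈ markovTypes P) (i : Fin N) : 0 ≤ rowSum θ i :=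
  sum_nonneg fun j _ => hθ.2.2.1 i j

lemma le_rowSum (hθ : θ ∈ markovTypes P) (i j : Fin N) : θ i j ≤ rowSum θ i :=
  single_le_sum (f := fun j => θ i j) (fun j _ => hθ.2.2.1 i j) (mem_univ j)

lemma eq_zero_of_rowSum_eq_zero (hθ : θ ∈ markovTypes P) {i : Fin N} (h : rowSum θ i = 0)
    (j : Fin N) : θ i j = 0 :=
  le_antisymm (h ▸ le_rowSum hθ i j) (hθ.2.2.1 i j)

lemma sum_rowSum (hθ : θ ∈ markovTypes P) : ∑ i, rowSum θ i = 1 := hθ.1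

lemma le_one_of_mem_markovTypes (hθ : θ ∈ markovTypes P) (i j : Fin N) : θ i j ≤ 1 :=
  (le_rowSum hθ i j).trans <| (single_le_sum (f := rowSum θ)
    (fun i _ => rowSum_nonneg hθ i) (mem_univ i)).trans (sum_rowSum hθ).le

lemma rowSum_combo (t s : ℝ) (i : Fin N) :
    rowSum (t • θ + s • η) i = t * rowSum θ i + s * rowSum η i := by
  simp [rowSum, sum_add_distrib, mul_sum]

lemma meanSNR_combo (t s : ℝ) :
    meanSNR β (t • θ + s • η) = t * meanSNR β θ + s * meanSNR β η := by
  simp only [meanSNR, rowSum_combo, mul_sum, ← sum_add_distrib]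
  exact sum_congr rfl fun i _ => by ring

lemma meanSNR_nonneg (hθ : θ ∈ markovTypes P) : 0 ≤ meanSNR β θ :=
  sum_nonneg fun i _ => mul_nonneg (rowSum_nonneg hθ i) (by positivity)

lemma convex_markovTypes : Convex ℝ (markovTypes P) := by
  intro θ hθ η hη t s ht hs hts
  refine ⟨?_, fun i => ?_, fun i j => ?_, fun i j h => ?_⟩
  · have h1 := sum_rowSum hθ
    have h2 := sum_rowSum hη
    change ∑ i, rowSum (t • θ + s • η) i = 1
    simp only [rowSum_combo, sum_add_distrib, ← mul_sum, h1, h2]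
    linarith
  · simp only [Matrix.add_apply, Matrix.smul_apply, smul_eq_mul, sum_add_distrib, ← mul_sum,
      hθ.2.1 i, hη.2.1 i]
  · simpa using add_nonneg (mul_nonneg ht (hθ.2.2.1 i j)) (mul_nonneg hs (hη.2.2.1 i j))
  · simp [hθ.2.2.2 i j h, hη.2.2.2 i j h]

lemma isCompact_markovTypes : IsCompact (markovTypes P) := by
  have hK : IsCompact (Set.univ.pi fun _ : Fin N => Set.univ.pi fun _ : Fin N =>
      Set.Icc (0 : ℝ) 1) :=
    isCompact_univ_pi fun _ => isCompact_univ_pi fun _ => isCompact_Icc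
  refine hK.of_isClosed_subset ?_ ?_
  · have h1 : IsClosed {θ : Matrix (Fin N) (Fin N) ℝ | ∑ i, ∑ j, θ i j = 1} :=
      isClosed_eq (by fun_prop) continuous_const
    have h2 : IsClosed {θ : Matrix (Fin N) (Fin N) ℝ | ∀ i, ∑ j, θ i j = ∑ j, θ j i} := by
      simp only [Set.ofPred_forall]
      exact isClosed_iInter fun i => isClosed_eq (by fun_prop) (by fun_prop)
    have h3 : IsClosed {θ : Matrix (Fin N) (Fin N) ℝ | ∀ i j, 0 ≤ θ i j} := by
      simp only [Set.ofPred_forall]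
      exact isClosed_iInter fun i => isClosed_iInter fun j =>
        isClosed_le continuous_const (by fun_prop)
    have h4 : IsClosed {θ : Matrix (Fin N) (Fin N) ℝ | ∀ i j, P i j = 0 → θ i j = 0} := by
      simp only [Set.ofPred_forall]
      exact isClosed_iInter fun i => isClosed_iInter fun j => isClosed_iInter fun _ =>
        isClosed_eq (by fun_prop) continuous_const
    exact h1.inter (h2.inter (h3.inter h4))
  · intro θ hθ i _ j _
    exact ⟨hθ.2.2.1 i j, le_one_of_mem_markovTypes hθ i j⟩

/-! ### Entropy and relative entropy -/

lemma entropy_nonneg (hθ : θ ∈ markovTypes P) : 0 ≤ entropy θ := by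
  rw [entropy, neg_nonneg]
  exact sum_nonpos fun i _ => sum_nonpos fun j _ =>
    mul_nonpos_of_nonneg_of_nonpos (hθ.2.2.1 i j) <|
      Real.log_nonpos (div_nonneg (hθ.2.2.1 i j) (rowSum_nonneg hθ i))
        (div_le_one_of_le₀ (le_rowSum hθ i j) (rowSum_nonneg hθ i))

lemma entropy_combo_ge (hθ : θ ∈ markovTypes P) (hη : η ∈ markovTypes P) {t s : ℝ}
    (ht : 0 ≤ t) (hs : 0 ≤ s) :
    t * entropy θ + s * entropy η ≤ entropy (t • θ + s • η) := by
  simp only [entropy, mul_neg, ← neg_add, neg_le_neg_iff, mul_sum, ← sum_add_distrib]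
  refine sum_le_sum fun i _ => sum_le_sum fun j _ => ?_
  rw [rowSum_combo]
  exact mul_log_div_convex (hθ.2.2.1 i j) (hη.2.2.1 i j) (rowSum_nonneg hθ i)
    (rowSum_nonneg hη i) (fun h => eq_zero_of_rowSum_eq_zero hθ h j)
    (fun h => eq_zero_of_rowSum_eq_zero hη h j) ht hs

/-- `Real.negMulLog` is continuous at 0, so this form gives continuity up to vanishing rows, which
the quotient form hides. -/
lemma entropy_eq_negMulLog (hθ : θ ∈ markovTypes P) :
    entropy θ = ∑ i, (∑ j, Real.negMulLog (θ i j) - Real.negMulLog (rowSum θ i)) := by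
  rw [entropy, ← sum_neg_distrib]
  refine sum_congr rfl fun i _ => ?_
  have : Real.negMulLog (rowSum θ i) = ∑ j, -(θ i j * Real.log (rowSum θ i)) := by
    rw [Real.negMulLog, sum_neg_distrib, ← sum_mul, neg_mul]; rfl
  rw [this, ← sum_sub_distrib, ← sum_neg_distrib]
  refine sum_congr rfl fun j _ => ?_
  rcases eq_or_ne (θ i j) 0 with h | h
  · simp [h]
  · have h' : rowSum θ i ≠ 0 := fun h' => h (eq_zero_of_rowSum_eq_zero hθ h' j)
    rw [Real.log_div h h', Real.negMulLog]
    ring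

lemma continuous_rowSum (i : Fin N) :
    Continuous fun θ : Matrix (Fin N) (Fin N) ℝ => rowSum θ i := by
  unfold rowSum
  fun_prop

lemma continuous_meanSNR : Continuous (meanSNR β) := by
  have := continuous_rowSum (N := N)
  unfold meanSNR
  fun_prop

lemma continuousOn_entropy : ContinuousOn entropy (markovTypes P) := by
  have := continuous_rowSum (N := N)
  have h : Continuous fun θ : Matrix (Fin N) (Fin N) ℝ =>
      ∑ i, (∑ j, Real.negMulLog (θ i j) - Real.negMulLog (rowSum θ i)) := by
    fun_prop
  exact h.continuousOn.congr fun θ hθ => entropy_eq_negMulLog hθ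

/-- The linear part of the relative entropy. -/
noncomputable def crossEntropy (P θ : Matrix (Fin N) (Fin N) ℝ) : ℝ :=
  -∑ i, ∑ j, θ i j * Real.log (P i j)

lemma continuous_crossEntropy : Continuous (crossEntropy P) := by
  unfold crossEntropy
  fun_prop

lemma crossEntropy_combo (t s : ℝ) :
    crossEntropy P (t • θ + s • η) = t * crossEntropy P θ + s * crossEntropy P η := by
  simp only [crossEntropy, mul_neg, ← neg_add, mul_sum, ← sum_add_distrib]
  congr 1
  exact sum_congr rfl fun i _ => sum_congr rfl fun j _ => by simp; ring

lemma relEntropy_eq (hθ : θ ∈ markovTypes P) :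
    relEntropy θ P = crossEntropy P θ - entropy θ := by
  simp only [relEntropy, crossEntropy, entropy, sub_neg_eq_add, neg_add_eq_sub,
    ← sum_sub_distrib]
  refine sum_congr rfl fun i _ => sum_congr rfl fun j _ => ?_
  rcases eq_or_ne (θ i j) 0 with h | h
  · simp [h]
  · have h' : rowSum θ i ≠ 0 := fun h' => h (eq_zero_of_rowSum_eq_zero hθ h' j)
    have hP : P i j ≠ 0 := fun hP => h (hθ.2.2.2 i j hP)
    rw [← div_div, Real.log_div (div_ne_zero h h') hP]
    ring

lemma relEntropy_combo_le (hθ : θ ∈ markovTypes P) (hη : η ∈ markovTypes P) {t s : ℝ}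
    (ht : 0 ≤ t) (hs : 0 ≤ s) (hts : t + s = 1) :
    relEntropy (t • θ + s • η) P ≤ t * relEntropy θ P + s * relEntropy η P := by
  rw [relEntropy_eq hθ, relEntropy_eq hη, relEntropy_eq (convex_markovTypes hθ hη ht hs hts),
    crossEntropy_combo]
  linarith [entropy_combo_ge hθ hη ht hs]

/-- Adding θ̄_i P_ij - θ_ij, which sums to zero because P is stochastic, makes every term
nonnegative and exposes the equality case. -/
lemma relEntropy_eq_klFun (hP : P ∈ Matrix.rowStochastic ℝ (Fin N)) (hθ : θ ∈ markovTypes P) :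
    relEntropy θ P =
      ∑ i, ∑ j, rowSum θ i * P i j * klFun (θ i j / (rowSum θ i * P i j)) := by
  have h1 : ∑ i, ∑ j, (rowSum θ i * P i j - θ i j) = 0 := by
    refine sum_eq_zero fun i _ => ?_
    rw [sum_sub_distrib, ← mul_sum, Matrix.sum_row_of_mem_rowStochastic hP, mul_one]
    exact sub_self _
  rw [relEntropy, ← add_zero (∑ i, _), ← h1, ← sum_add_distrib]
  refine sum_congr rfl fun i _ => ?_
  rw [← sum_add_distrib]
  refine sum_congr rfl fun j _ => ?_
  rcases eq_or_ne (rowSum θ i * P i j) 0 with h | h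
  · have : θ i j = 0 := by
      rcases mul_eq_zero.1 h with h | h
      exacts [eq_zero_of_rowSum_eq_zero hθ h j, hθ.2.2.2 i j h]
    simp [this, h]
  · rw [klFun_apply, mul_sub, mul_add, ← mul_assoc, mul_div_cancel₀ _ h]
    ring

lemma relEntropy_term_nonneg (hP : P ∈ Matrix.rowStochastic ℝ (Fin N)) (hθ : θ ∈ markovTypes P)
    (i j : Fin N) :
    0 ≤ rowSum θ i * P i j * klFun (θ i j / (rowSum θ i * P i j)) := by
  have h : 0 ≤ rowSum θ i * P i j := mul_nonneg (rowSum_nonneg hθ i) (hP.1 i j)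
  exact mul_nonneg h (klFun_nonneg (div_nonneg (hθ.2.2.1 i j) h))

lemma relEntropy_nonneg (hP : P ∈ Matrix.rowStochastic ℝ (Fin N)) (hθ : θ ∈ markovTypes P) :
    0 ≤ relEntropy θ P := by
  rw [relEntropy_eq_klFun hP hθ]
  exact sum_nonneg fun i _ => sum_nonneg fun j _ => relEntropy_term_nonneg hP hθ i j

lemma eq_mul_of_relEntropy_eq_zero (hP : P ∈ Matrix.rowStochastic ℝ (Fin N))
    (hθ : θ ∈ markovTypes P) (h : relEntropy θ P = 0) (i j : Fin N) :
    θ i j = rowSum θ i * P i j := by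
  rw [relEntropy_eq_klFun hP hθ, sum_eq_zero_iff_of_nonneg fun i _ =>
    sum_nonneg fun j _ => relEntropy_term_nonneg hP hθ i j] at h
  have h1 := (sum_eq_zero_iff_of_nonneg fun j _ => relEntropy_term_nonneg hP hθ i j).1
    (h i (mem_univ i)) j (mem_univ j)
  have h0 : 0 ≤ rowSum θ i * P i j := mul_nonneg (rowSum_nonneg hθ i) (hP.1 i j)
  rcases mul_eq_zero.1 h1 with h1 | h1
  · rw [h1]
    rcases mul_eq_zero.1 h1 with h2 | h2
    exacts [eq_zero_of_rowSum_eq_zero hθ h2 j, hθ.2.2.2 i j h2]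
  · rw [klFun_eq_zero_iff (div_nonneg (hθ.2.2.1 i j) h0)] at h1
    exact eq_of_div_eq_one h1

/-! ### Stationary distributions -/

lemma vecMul_pow_of_vecMul_eq {v : Fin N → ℝ} (hv : v ᵥ* P = v) (k : ℕ) : v ᵥ* P ^ k = v := by
  induction k with
  | zero => simp
  | succ k ih => rw [pow_succ, ← Matrix.vecMul_vecMul, ih, hv]

/-- A nonnegative invariant vector of an irreducible matrix with a zero entry vanishes. -/
lemma eq_zero_of_invariant (hirr : P.IsIrreducible) {v : Fin N → ℝ} (hv0 : ∀ i, 0 ≤ v i)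
    (hv : v ᵥ* P = v) {i : Fin N} (hi : v i = 0) : v = 0 := by
  funext j
  obtain ⟨k, -, hk⟩ := (Matrix.isIrreducible_iff_exists_pow_pos hirr.nonneg).1 hirr j i
  have h := congrFun (vecMul_pow_of_vecMul_eq hv k) i
  rw [hi, Matrix.vecMul, dotProduct, sum_eq_zero_iff_of_nonneg fun l _ =>
    mul_nonneg (hv0 l) (Matrix.pow_apply_nonneg hirr.nonneg k l i)] at h
  exact (mul_eq_zero.1 (h j (mem_univ j))).resolve_right hk.ne'

lemma IsStationary.pos (hirr : P.IsIrreducible) (hπ : IsStationary P π) (i : Fin N) :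
    0 < π i := by
  refine lt_of_le_of_ne (hπ.1.1 i) fun h => ?_
  have := hπ.1.2
  rw [eq_zero_of_invariant hirr hπ.1.1 hπ.2 h.symm] at this
  simp at this

/-- Subtract from ρ the largest multiple of π that keeps it nonnegative. The difference is invariant
with a zero entry, hence vanishes, and normalization fixes the multiple. -/
lemma IsStationary.unique (hirr : P.IsIrreducible) (hπ : IsStationary P π) {ρ : Fin N → ℝ}
    (hρ : IsStationary P ρ) : ρ = π := by
  have hpos := hπ.pos hirr
  have hne : (univ : Finset (Fin N)).Nonempty := by
    rw [nonempty_iff_ne_empty]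
    intro h
    have := hπ.1.2
    rw [h] at this
    simp at this
  obtain ⟨i, -, hi⟩ := exists_min_image univ (fun i => ρ i / π i) hne
  have h := eq_zero_of_invariant hirr (v := ρ - (ρ i / π i) • π) (i := i)
    (fun j => by
      have := (le_div_iff₀ (hpos j)).1 (hi j (mem_univ j))
      simpa using this)
    (by rw [Matrix.sub_vecMul, Matrix.smul_vecMul, hρ.2, hπ.2])
    (by simp [(hpos i).ne'])
  rw [sub_eq_zero] at h
  have h1 := hρ.1.2
  rw [h] at h1
  simp only [Pi.smul_apply, smul_eq_mul, ← mul_sum, hπ.1.2, mul_one] at h1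
  rw [h, h1, one_smul]

/-- The pair distribution of the stationary chain. -/
def pairDist (P : Matrix (Fin N) (Fin N) ℝ) (π : Fin N → ℝ) : Matrix (Fin N) (Fin N) ℝ :=
  Matrix.of fun i j => π i * P i j

lemma rowSum_pairDist (hP : P ∈ Matrix.rowStochastic ℝ (Fin N)) (i : Fin N) :
    rowSum (pairDist P π) i = π i := by
  simp [rowSum, pairDist, ← mul_sum, Matrix.sum_row_of_mem_rowStochastic hP]

lemma pairDist_mem (hP : P ∈ Matrix.rowStochastic ℝ (Fin N)) (hπ : IsStationary P π) :
    pairDist P π ∈ markovTypes P := by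
  refine ⟨?_, fun i => ?_, fun i j => mul_nonneg (hπ.1.1 i) (hP.1 i j), fun i j h => ?_⟩
  · change ∑ i, rowSum (pairDist P π) i = 1
    simp only [rowSum_pairDist hP, hπ.1.2]
  · exact (rowSum_pairDist hP i).trans (congrFun hπ.2 i).symm
  · simp [pairDist, h]

lemma crossEntropy_pairDist : crossEntropy P (pairDist P π) = entropyRate P π := rfl

lemma meanSNR_pairDist (hP : P ∈ Matrix.rowStochastic ℝ (Fin N)) :
    meanSNR β (pairDist P π) = ∑ i, π i * (β i ^ 2 / 2) := by
  simp only [meanSNR, rowSum_pairDist hP]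

lemma relEntropy_pairDist (hP : P ∈ Matrix.rowStochastic ℝ (Fin N)) :
    relEntropy (pairDist P π) P = 0 := by
  refine sum_eq_zero fun i _ => sum_eq_zero fun j _ => ?_
  rw [rowSum_pairDist hP]
  simp only [pairDist, Matrix.of_apply]
  rcases eq_or_ne (π i * P i j) 0 with h | h
  · simp [h]
  · simp [div_self h]

lemma entropy_pairDist (hP : P ∈ Matrix.rowStochastic ℝ (Fin N)) (hπ : IsStationary P π) :
    entropy (pairDist P π) = entropyRate P π := by
  have h := relEntropy_eq (pairDist_mem hP hπ)
  rw [relEntropy_pairDist hP, crossEntropy_pairDist] at h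
  linarith

/-- D = 0 forces θ_ij = θ̄_i P_ij; equality of the marginals then makes θ̄ stationary. -/
lemma eq_pairDist_of_relEntropy_eq_zero (hP : P ∈ Matrix.rowStochastic ℝ (Fin N))
    (hirr : P.IsIrreducible) (hπ : IsStationary P π) (hθ : θ ∈ markovTypes P)
    (h : relEntropy θ P = 0) : θ = pairDist P π := by
  have h1 := eq_mul_of_relEntropy_eq_zero hP hθ h
  have h2 : IsStationary P (rowSum θ) := by
    refine ⟨⟨rowSum_nonneg hθ, sum_rowSum hθ⟩, funext fun j => ?_⟩
    exact (sum_congr rfl fun i _ => (h1 i j).symm).trans (hθ.2.1 j).symm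
  ext i j
  rw [h1, hπ.unique hirr h2, pairDist, Matrix.of_apply]

/-! ### Partial minimization over `ξ` -/

/-- The minimum over `ξ` of the objective of the original problem. -/
noncomputable def reducedObjective (P : Matrix (Fin N) (Fin N) ℝ) (β : Fin N → ℝ)
    (θ : Matrix (Fin N) (Fin N) ℝ) : ℝ :=
  relEntropy θ P + max 0 (√(meanSNR β θ) - √(entropy θ)) ^ 2

lemma sum_filter_rowSum (hθ : θ ∈ markovTypes P) (f : Fin N → ℝ)
    (hf : ∀ i, rowSum θ i = 0 → f i = 0) :
    ∑ i with 0 < rowSum θ i, f i = ∑ i, f i :=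
  sum_filter_of_ne fun i _ hi =>
    lt_of_le_of_ne (rowSum_nonneg hθ i) fun h => hi (hf i h.symm)

lemma J_eq (hθ : θ ∈ markovTypes P) (κ : Fin N → ℝ) :
    J θ (fun i => rowSum θ i * κ i) = ((∑ i, rowSum θ i * (κ i ^ 2 / 2) : ℝ) : EReal) := by
  rw [J, if_pos fun i hi => by rw [hi, zero_mul],
    ← sum_filter_rowSum hθ _ fun i hi => by rw [hi, zero_mul]]
  congr 1
  refine sum_congr rfl fun i hi => ?_
  have := (mem_filter.1 hi).2
  field_simp

lemma boundObjective_eq (hθ : θ ∈ markovTypes P) (κ : Fin N → ℝ) :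
    boundObjective P β (θ, fun i => rowSum θ i * κ i) =
      relEntropy θ P + ∑ i, rowSum θ i * ((β i - κ i) ^ 2 / 2) := by
  rw [boundObjective, ← sum_filter_rowSum hθ _ fun i hi => by rw [hi, zero_mul]]
  congr 1
  refine sum_congr rfl fun i hi => ?_
  have := (mem_filter.1 hi).2
  field_simp

lemma boundFeasible_iff (κ : Fin N → ℝ) :
    (θ, fun i => rowSum θ i * κ i) ∈ boundFeasible P ↔
      θ ∈ markovTypes P ∧ ∑ i, rowSum θ i * (κ i ^ 2 / 2) ≤ entropy θ := by
  refine and_congr_right fun hθ => ?_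
  rw [J_eq hθ, EReal.coe_le_coe_iff]

/-- A finite J forces ξ to vanish on null rows, so the value of κ there is immaterial. -/
lemma exists_eq_mul_of_mem_boundFeasible {ξ : Fin N → ℝ} (h : (θ, ξ) ∈ boundFeasible P) :
    ∃ κ : Fin N → ℝ, ξ = fun i => rowSum θ i * κ i := by
  refine ⟨fun i => ξ i / rowSum θ i, funext fun i => ?_⟩
  have h2 : ∀ i, rowSum θ i = 0 → ξ i = 0 := by
    by_contra hc
    have := h.2
    rw [J, if_neg hc] at this
    exact EReal.coe_ne_top _ (top_le_iff.1 this)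
  rcases eq_or_ne (rowSum θ i) 0 with hi | hi
  · rw [h2 i hi, hi, zero_mul]
  · rw [mul_div_cancel₀ _ hi]

/-- Reverse triangle inequality, through Cauchy–Schwarz in the weighted inner product: a point of
norm √T is at distance at least √R - √T from β. -/
lemma reducedObjective_le {ξ : Fin N → ℝ} (h : (θ, ξ) ∈ boundFeasible P) :
    reducedObjective P β θ ≤ boundObjective P β (θ, ξ) := by
  obtain ⟨κ, rfl⟩ := exists_eq_mul_of_mem_boundFeasible h
  obtain ⟨hθ, hκ⟩ := (boundFeasible_iff κ).1 h
  rw [boundObjective_eq hθ, reducedObjective]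
  gcongr
  set T := ∑ i, rowSum θ i * (κ i ^ 2 / 2) with hT
  set B := ∑ i, rowSum θ i * (β i * κ i / 2) with hB
  have hm := rowSum_nonneg hθ
  have hQ0 : 0 ≤ ∑ i, rowSum θ i * ((β i - κ i) ^ 2 / 2) :=
    sum_nonneg fun i _ => mul_nonneg (hm i) (by positivity)
  have hT0 : 0 ≤ T := sum_nonneg fun i _ => mul_nonneg (hm i) (by positivity)
  have hS0 : 0 ≤ meanSNR β θ := meanSNR_nonneg hθ
  have hQ : ∑ i, rowSum θ i * ((β i - κ i) ^ 2 / 2) = meanSNR β θ - 2 * B + T := by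
    rw [meanSNR, hT, hB, mul_sum, ← sum_sub_distrib, ← sum_add_distrib]
    exact sum_congr rfl fun i _ => by ring
  have hCS : B ^ 2 ≤ meanSNR β θ * T := by
    have h := sum_mul_sq_le_sq_mul_sq univ (fun i => √(rowSum θ i / 2) * β i)
      (fun i => √(rowSum θ i / 2) * κ i)
    have e (i : Fin N) : √(rowSum θ i / 2) ^ 2 = rowSum θ i / 2 :=
      Real.sq_sqrt (div_nonneg (hm i) zero_le_two)
    have e1 : ∑ i, √(rowSum θ i / 2) * β i * (√(rowSum θ i / 2) * κ i) = B :=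
      sum_congr rfl fun i _ => by linear_combination (β i * κ i) * e i
    have e2 : ∑ i, (√(rowSum θ i / 2) * β i) ^ 2 = meanSNR β θ :=
      sum_congr rfl fun i _ => by linear_combination (β i ^ 2) * e i
    have e3 : ∑ i, (√(rowSum θ i / 2) * κ i) ^ 2 = T :=
      sum_congr rfl fun i _ => by linear_combination (κ i ^ 2) * e i
    rwa [e1, e2, e3] at h
  have hB' : B ≤ √(meanSNR β θ) * √T := by
    rw [← Real.sqrt_mul hS0]
    exact Real.le_sqrt_of_sq_le hCS
  have hTh : √T ≤ √(entropy θ) := Real.sqrt_le_sqrt hκ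
  rcases le_total (√(meanSNR β θ) - √(entropy θ)) 0 with h0 | h0
  · rw [max_eq_left h0]
    simpa using hQ0
  · rw [max_eq_right h0]
    -- Here √T ≤ √H ≤ √R, so the base is nonnegative and squaring is monotone.
    calc (√(meanSNR β θ) - √(entropy θ)) ^ 2 ≤ (√(meanSNR β θ) - √T) ^ 2 := by gcongr
      _ ≤ _ := by
        rw [hQ, sub_sq, Real.sq_sqrt hS0, Real.sq_sqrt hT0]
        linarith

/-- The nearest point of the ball is a multiple c β: c = 1 if β already lies inside, and c = √H / √R
for the radial projection otherwise. -/
lemma exists_boundObjective_eq (β : Fin N → ℝ) (hθ : θ ∈ markovTypes P) :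
    ∃ ξ, (θ, ξ) ∈ boundFeasible P ∧ boundObjective P β (θ, ξ) = reducedObjective P β θ := by
  suffices h : ∃ c : ℝ, c ^ 2 * meanSNR β θ ≤ entropy θ ∧
      (1 - c) ^ 2 * meanSNR β θ = max 0 (√(meanSNR β θ) - √(entropy θ)) ^ 2 by
    obtain ⟨c, h1, h2⟩ := h
    refine ⟨fun i => rowSum θ i * (c * β i), (boundFeasible_iff _).2 ⟨hθ, ?_⟩, ?_⟩
    · convert h1 using 1
      rw [meanSNR, mul_sum]
      exact sum_congr rfl fun i _ => by ring
    · rw [boundObjective_eq hθ, reducedObjective, ← h2, meanSNR, mul_sum]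
      congr 1
      exact sum_congr rfl fun i _ => by ring
  have hS0 : 0 ≤ meanSNR β θ := meanSNR_nonneg hθ
  have hH0 : 0 ≤ entropy θ := entropy_nonneg hθ
  rcases le_or_gt (meanSNR β θ) (entropy θ) with h | h
  · refine ⟨1, by simpa using h, ?_⟩
    rw [max_eq_left (sub_nonpos.2 (Real.sqrt_le_sqrt h))]
    simp
  · have hS : 0 < √(meanSNR β θ) := Real.sqrt_pos.2 (hH0.trans_lt h)
    have e1 := Real.sq_sqrt hS0
    have e2 := Real.sq_sqrt hH0
    refine ⟨√(entropy θ) / √(meanSNR β θ), le_of_eq ?_, ?_⟩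
    · rw [div_pow, e1, e2, div_mul_cancel₀ _ (hH0.trans_lt h).ne']
    · rw [max_eq_right (sub_nonneg.2 (Real.sqrt_le_sqrt h.le))]
      nth_rw 2 [← e1]
      rw [← mul_pow]
      congr 1
      field_simp

lemma continuousOn_reducedObjective :
    ContinuousOn (reducedObjective P β) (markovTypes P) := by
  have h1 : ContinuousOn entropy (markovTypes P) := continuousOn_entropy
  have h2 : ContinuousOn (fun θ => relEntropy θ P) (markovTypes P) :=
    (continuous_crossEntropy.continuousOn.sub h1).congr fun θ hθ => relEntropy_eq hθ
  have h3 : ContinuousOn (meanSNR β) (markovTypes P) := continuous_meanSNR.continuousOn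
  exact h2.add ((continuousOn_const.sup (h3.sqrt.sub h1.sqrt)).pow 2)

lemma reducedObjective_nonneg (hP : P ∈ Matrix.rowStochastic ℝ (Fin N))
    (hθ : θ ∈ markovTypes P) : 0 ≤ reducedObjective P β θ :=
  add_nonneg (relEntropy_nonneg hP hθ) (sq_nonneg _)

lemma reducedObjective_of_meanSNR_le (h : meanSNR β θ ≤ entropy θ) :
    reducedObjective P β θ = relEntropy θ P := by
  rw [reducedObjective, max_eq_left (sub_nonpos.2 (Real.sqrt_le_sqrt h))]
  simp

lemma exists_isMinOn_reducedObjective (hP : P ∈ Matrix.rowStochastic ℝ (Fin N))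
    (hπ : IsStationary P π) (β : Fin N → ℝ) :
    ∃ θ ∈ markovTypes P, IsMinOn (reducedObjective P β) (markovTypes P) θ :=
  isCompact_markovTypes.exists_isMinOn ⟨_, pairDist_mem hP hπ⟩ continuousOn_reducedObjective

lemma isLeast_boundObjective (hθ : θ ∈ markovTypes P)
    (hmin : IsMinOn (reducedObjective P β) (markovTypes P) θ) :
    IsLeast (boundObjective P β '' boundFeasible P) (reducedObjective P β θ) := by
  obtain ⟨ξ, hξ, he⟩ := exists_boundObjective_eq β hθ
  refine ⟨⟨_, hξ, he⟩, ?_⟩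
  rintro _ ⟨⟨η, ξ'⟩, hη, rfl⟩
  exact (hmin hη.1).trans (reducedObjective_le hη)

lemma exists_isMinOn_boundObjective_iff :
    (∃ ξ : Fin N → ℝ, (θ, ξ) ∈ boundFeasible P ∧
      IsMinOn (boundObjective P β) (boundFeasible P) (θ, ξ)) ↔
    θ ∈ markovTypes P ∧ IsMinOn (reducedObjective P β) (markovTypes P) θ := by
  constructor
  · rintro ⟨ξ, hξ, hmin⟩
    refine ⟨hξ.1, fun η hη => ?_⟩
    obtain ⟨ξ', hξ', he⟩ := exists_boundObjective_eq β hη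
    exact (reducedObjective_le hξ).trans ((hmin hξ').trans he.le)
  · rintro ⟨hθ, hmin⟩
    obtain ⟨ξ, hξ, he⟩ := exists_boundObjective_eq β hθ
    exact ⟨ξ, hξ, fun ⟨η, ξ'⟩ hη => he.le.trans ((hmin hη.1).trans (reducedObjective_le hη))⟩

/-! ### The convex reformulation -/

lemma cvxObjective_eq (hθ : θ ∈ markovTypes P) :
    cvxObjective P β θ = relEntropy θ P + (√(meanSNR β θ) - √(entropy θ)) ^ 2 := by
  rw [relEntropy_eq hθ, sub_sq, Real.sq_sqrt (meanSNR_nonneg hθ),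
    Real.sq_sqrt (entropy_nonneg hθ), cvxObjective, crossEntropy]
  ring

lemma reducedObjective_le_cvxObjective (hθ : θ ∈ markovTypes P) :
    reducedObjective P β θ ≤ cvxObjective P β θ := by
  rw [cvxObjective_eq hθ, reducedObjective]
  refine add_le_add le_rfl ?_
  rcases le_total (√(meanSNR β θ) - √(entropy θ)) 0 with h | h
  · rw [max_eq_left h]
    simpa using sq_nonneg (√(meanSNR β θ) - √(entropy θ))
  · rw [max_eq_right h]

lemma reducedObjective_eq_cvxObjective (hθ : θ ∈ markovTypes P)
    (h : entropy θ ≤ meanSNR β θ) : reducedObjective P β θ = cvxObjective P β θ := by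
  rw [cvxObjective_eq hθ, reducedObjective, max_eq_right (sub_nonneg.2 (Real.sqrt_le_sqrt h))]

lemma convexOn_cvxObjective : ConvexOn ℝ (markovTypes P) (cvxObjective P β) := by
  refine ⟨convex_markovTypes, fun θ hθ η hη t s ht hs _ => ?_⟩
  have h1 := sqrt_mul_sqrt_concave (meanSNR_nonneg (β := β) hθ) (entropy_nonneg hθ)
    (meanSNR_nonneg (β := β) hη) (entropy_nonneg hη) ht hs
  have h2 := mul_le_mul_of_nonneg_left (Real.sqrt_le_sqrt (entropy_combo_ge hθ hη ht hs))
    (Real.sqrt_nonneg (t * meanSNR β θ + s * meanSNR β η))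
  change crossEntropy P _ + meanSNR β _ - _ ≤ t * (crossEntropy P θ + meanSNR β θ - _) +
    s * (crossEntropy P η + meanSNR β η - _)
  rw [crossEntropy_combo, meanSNR_combo]
  linarith

/-- If the entropy rate is small, the minimizers of the reduced objective lie in the region where
it agrees with the convex objective. -/
lemma entropy_le_meanSNR_of_isMinOn (hP : P ∈ Matrix.rowStochastic ℝ (Fin N))
    (hirr : P.IsIrreducible) (hπ : IsStationary P π)
    (hlt : entropyRate P π < ∑ i, π i * (β i ^ 2 / 2)) (hθ : θ ∈ markovTypes P)
    (hmin : IsMinOn (reducedObjective P β) (markovTypes P) θ) :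
    entropy θ ≤ meanSNR β θ := by
  by_contra! hc
  have hp := pairDist_mem hP hπ
  rw [← entropy_pairDist hP hπ, ← meanSNR_pairDist hP] at hlt
  -- At the pair distribution H < R, contrary to `hc`, so θ differs from it.
  have hD : 0 < relEntropy θ P := by
    refine lt_of_le_of_ne (relEntropy_nonneg hP hθ) fun h => ?_
    rw [eq_pairDist_of_relEntropy_eq_zero hP hirr hπ hθ h.symm] at hc
    exact hlt.not_gt hc
  let γ : ℝ → Matrix (Fin N) (Fin N) ℝ := fun t => (1 - t) • θ + t • pairDist P π
  have hγ : Set.MapsTo γ (Set.Icc 0 1) (markovTypes P) := fun t ht =>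
    convex_markovTypes hθ hp (sub_nonneg.2 ht.2) ht.1 (by ring)
  have hγc : Continuous γ := by fun_prop
  have hcont : ContinuousOn (fun t => meanSNR β (γ t) - entropy (γ t)) (Set.Icc 0 1) :=
    (continuous_meanSNR.comp hγc).continuousOn.sub
      (continuousOn_entropy.comp hγc.continuousOn hγ)
  have hγ0 : γ 0 = θ := by simp [γ]
  have hγ1 : γ 1 = pairDist P π := by simp [γ]
  obtain ⟨t, ht, h0⟩ := intermediate_value_Icc zero_le_one hcont
    (show (0 : ℝ) ∈ Set.Icc _ _ by
      simp only [hγ0, hγ1, Set.mem_Icc]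
      constructor <;> linarith)
  have ht0 : 0 < t := by
    refine lt_of_le_of_ne ht.1 ?_
    rintro rfl
    simp only [hγ0] at h0
    linarith
  have h1 := isMinOn_iff.1 hmin (γ t) (hγ ht)
  rw [reducedObjective_of_meanSNR_le hc.le,
    reducedObjective_of_meanSNR_le (sub_eq_zero.1 h0).le] at h1
  -- At the crossing point H = R the penalty is zero, and convexity gives D(γ t) ≤ (1 - t) D(θ) <
  -- D(θ), against minimality.
  have h2 := relEntropy_combo_le hθ hp (sub_nonneg.2 ht.2) ht.1 (by ring)
  rw [relEntropy_pairDist hP] at h2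
  linarith [mul_pos ht0 hD]

end RandomWalkDetection

open RandomWalkDetection in
theorem mainTheorem3 (N : ℕ) (P : Matrix (Fin N) (Fin N) ℝ)
    (hP : P ∈ Matrix.rowStochastic ℝ (Fin N))
    (hirr : P.IsIrreducible) (haper : RandomWalkDetection.IsAperiodic P)
    (π : Fin N → ℝ) (hπ : RandomWalkDetection.IsStationary P π)
    (β : Fin N → ℝ) :
    -- the optimal value of the original problem is attained
    IsLeast (RandomWalkDetection.boundObjective P β '' RandomWalkDetection.boundFeasible P)
      (RandomWalkDetection.zetaLower P β) ∧
    -- the case of large entropy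
    (∑ i, π i * (β i ^ 2 / 2) ≤ RandomWalkDetection.entropyRate P π →
      RandomWalkDetection.zetaLower P β = 0) ∧
    -- the reformulated problem is convex
    ConvexOn ℝ (RandomWalkDetection.markovTypes P) (RandomWalkDetection.cvxObjective P β) ∧
    -- the other case: same optimal value, and the same optimal `θ`
    (RandomWalkDetection.entropyRate P π < ∑ i, π i * (β i ^ 2 / 2) →
      IsLeast (RandomWalkDetection.cvxObjective P β '' RandomWalkDetection.markovTypes P)
        (RandomWalkDetection.zetaLower P β) ∧
      ∀ θ : Matrix (Fin N) (Fin N) ℝ,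
        (θ ∈ RandomWalkDetection.markovTypes P ∧
          IsMinOn (RandomWalkDetection.cvxObjective P β)
            (RandomWalkDetection.markovTypes P) θ) ↔
        ∃ ξ : Fin N → ℝ, (θ, ξ) ∈ RandomWalkDetection.boundFeasible P ∧
          IsMinOn (RandomWalkDetection.boundObjective P β)
            (RandomWalkDetection.boundFeasible P) (θ, ξ)) := by
  obtain ⟨θ₀, hθ₀, hmin⟩ := exists_isMinOn_reducedObjective hP hπ β
  have hleast := isLeast_boundObjective hθ₀ hmin
  have hz : zetaLower P β = reducedObjective P β θ₀ := hleast.csInf_eq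
  rw [hz]
  refine ⟨hleast, fun h => ?_, convexOn_cvxObjective, fun hlt => ?_⟩
  · have hp := pairDist_mem hP hπ
    refine le_antisymm ((isMinOn_iff.1 hmin _ hp).trans ?_) (reducedObjective_nonneg hP hθ₀)
    rw [reducedObjective_of_meanSNR_le, relEntropy_pairDist hP]
    rwa [meanSNR_pairDist hP, entropy_pairDist hP hπ]
  have heq {θ : Matrix (Fin N) (Fin N) ℝ} (hθ : θ ∈ markovTypes P)
      (h : IsMinOn (reducedObjective P β) (markovTypes P) θ) :
      reducedObjective P β θ = cvxObjective P β θ :=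
    reducedObjective_eq_cvxObjective hθ (entropy_le_meanSNR_of_isMinOn hP hirr hπ hlt hθ h)
  refine ⟨⟨⟨θ₀, hθ₀, (heq hθ₀ hmin).symm⟩, ?_⟩, fun θ => ?_⟩
  · rintro _ ⟨η, hη, rfl⟩
    exact (hmin hη).trans (reducedObjective_le_cvxObjective hη)
  · rw [exists_isMinOn_boundObjective_iff]
    refine and_congr_right fun hθ => ⟨fun h η hη => ?_, fun h η hη => ?_⟩
    -- Comparing with `θ₀`, where the two objectives agree, carries optimality for (B) back to the
    -- reduced problem.
    · exact (reducedObjective_le_cvxObjective hθ).trans ((h hθ₀).trans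
        ((heq hθ₀ hmin).symm.le.trans (hmin hη)))
    · exact (heq hθ h).symm.le.trans ((h hη).trans (reducedObjective_le_cvxObjective hη))
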